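/- Let $\mathcal K$ be a locally finitely presentable additive category: $\mathcal K$ is additive and cocomplete, and there is, up to isomorphism, a set $\mathcal A$ of finitely presentable objects such that every object of $\mathcal K$ is a directed colimit of objects from $\mathcal A$ (an object $M$ is finitely presentable if $\operatorname{Hom}(M,-)$ preserves directed colimits). Call a morphism $h\colon K\to L$ of $\mathcal K$ pure if, for every commutative square $hu=vf$ with $f\colon M\to N$, $u\colon M\to K$, $v\colon N\to L$ and $M,N$ finitely presentable, there is a morphism $g\colon N\to K$ with $u=gf$; a pure monomorphism is a monomorphism that is pure. An object $J$ is pure injective if for every pure monomorphism $h\colon K\to L$, every morphism $K\to J$ factors through $h$. Then $\mathcal K$ has enough pure injectives; that is, for every object $X$ of $\mathcal K$ there is a pure monomorphism $X\to J$ with $J$ pure injective. -/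

import Mathlib

universe w v u

namespace PurityLFP

open CategoryTheory

/-- A morphism `h : K ⟶ L` is pure (that is, `ℵ₀`-pure) if in every commutative square
`u ≫ h = f ≫ v` with `f : M ⟶ N` a morphism between finitely presentable objects, the
morphism `u : M ⟶ K` factors through `f`. Finite presentability refers to the preservation of
filtered colimits indexed by categories in `Type w`, the universe of small sets. -/
def pure (C : Type u) [Category.{v} C] : MorphismProperty C := fun K L h =>
  ∀ ⦃M N : C⦄, IsFinitelyPresentable.{w} M → IsFinitelyPresentable.{w} N →
    ∀ (f : M ⟶ N) (u : M ⟶ K) (v : N ⟶ L), u ≫ h = f ≫ v → ∃ g : N ⟶ K, f ≫ g = u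

/-- A pure monomorphism is a monomorphism that is pure. -/
def pureMono (C : Type u) [Category.{v} C] : MorphismProperty C :=
  pure.{w} C ⊓ MorphismProperty.monomorphisms C

/-- An object is pure injective if it is injective with respect to pure monomorphisms. -/
def IsPureInjective {C : Type u} [Category.{v} C] (J : C) : Prop :=
  ∀ ⦃K L : C⦄ (h : K ⟶ L), pureMono.{w} C h → ∀ g : K ⟶ J, ∃ g' : L ⟶ J, h ≫ g' = g

/-- A category has enough pure injectives if every object admits a pure monomorphism to a
pure injective object. -/
def EnoughPureInjectives (C : Type u) [Category.{v} C] : Prop :=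
  ∀ X : C, ∃ (J : C) (j : X ⟶ J), pureMono.{w} C j ∧ IsPureInjective.{w} J

end PurityLFP

namespace PurityLFP

open CategoryTheory Limits Cardinal

attribute [local instance] fact_isRegular_aleph0

/-! ### Double characters of Hom groups. -/

section Character

/-! Write `⁺` for the character group `Hom(-, ℚ/ℤ)`, and let `A` be a small model of the finitely
presentable objects. Objects of `C` are controlled by their functors `Hom(ι -, K)` on `A`. The
functor `Hom(ι -, X)⁺⁺` carries cokernel sequences to exact ones, so its category of elements is
filtered and the colimit `J` of these elements represents it.

Evaluation `Hom(ι -, X) → Hom(ι -, X)⁺⁺` gives `X ⟶ J`, a pure monomorphism because characters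
separate points of every quotient. By tensor-hom adjunction, maps `K ⟶ J` are characters of `Hom(ι
-, K) ⊗ Hom(ι -, X)⁺`. Pure morphisms stay injective after tensoring, and `ℚ/ℤ` is injective, so `J`
is pure injective. -/

lemma exact_characterModule_dual {A B D : Type*} [AddCommGroup A] [AddCommGroup B]
    [AddCommGroup D] {f : A →ₗ[ℤ] B} {g : B →ₗ[ℤ] D} (h : Function.Exact f g) :
    Function.Exact (CharacterModule.dual g) (CharacterModule.dual f) := by
  intro φ
  constructor
  · intro hφ
    let k : (B ⧸ LinearMap.ker g) →ₗ[ℤ] D := (LinearMap.ker g).liftQ g le_rfl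
    have hk : Function.Injective k := by
      rw [← LinearMap.ker_eq_bot]
      exact Submodule.ker_liftQ_eq_bot _ _ _ le_rfl
    let φ' : CharacterModule (B ⧸ LinearMap.ker g) :=
      ((LinearMap.ker g).liftQ (AddMonoidHom.toIntLinearMap φ) (by
        intro b hb
        obtain ⟨a, rfl⟩ := (h b).1 hb
        exact DFunLike.congr_fun hφ a)).toAddMonoidHom
    obtain ⟨ψ, hψ⟩ := CharacterModule.dual_surjective_of_injective k hk φ'
    refine ⟨ψ, ?_⟩
    ext b
    exact DFunLike.congr_fun hψ (Submodule.Quotient.mk b)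
  · rintro ⟨ψ, rfl⟩
    ext a
    change ψ (g (f a)) = 0
    rw [h.apply_apply_eq_zero, map_zero]

variable {C : Type u} [Category.{v} C] [Preadditive C] (X : C)

/-- The map on characters of `Hom(-, X)` induced by precomposition with a morphism. -/
def charMap {M N : C} (f : M ⟶ N) :
    CharacterModule (M ⟶ X) →ₗ[ℤ] CharacterModule (N ⟶ X) :=
  CharacterModule.dual (Preadditive.leftComp X f).toIntLinearMap

/-- The map on double characters of `Hom(-, X)` induced by precomposition with a morphism. -/
def bicharMap {M N : C} (f : M ⟶ N) :
    CharacterModule (CharacterModule (N ⟶ X)) →ₗ[ℤ]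
      CharacterModule (CharacterModule (M ⟶ X)) :=
  CharacterModule.dual (charMap X f)

/-- Evaluation at a morphism, as a double character. -/
def evalChar {M : C} (u : M ⟶ X) : CharacterModule (CharacterModule (M ⟶ X)) where
  toFun χ := χ u
  map_zero' := rfl
  map_add' _ _ := rfl

variable {X}

@[simp]
lemma charMap_apply {M N : C} (f : M ⟶ N) (χ : CharacterModule (M ⟶ X)) (g : N ⟶ X) :
    charMap X f χ g = χ (f ≫ g) := rfl

@[simp]
lemma bicharMap_apply {M N : C} (f : M ⟶ N) (ξ : CharacterModule (CharacterModule (N ⟶ X)))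
    (χ : CharacterModule (M ⟶ X)) : bicharMap X f ξ χ = ξ (charMap X f χ) := rfl

@[simp]
lemma charMap_id (M : C) : charMap X (𝟙 M) = LinearMap.id := by
  ext χ g
  simp

lemma charMap_comp {M N P : C} (f : M ⟶ N) (g : N ⟶ P) :
    charMap X (f ≫ g) = (charMap X g).comp (charMap X f) := by
  ext χ h
  simp

lemma charMap_zero (M N : C) : charMap X (0 : M ⟶ N) = 0 := by
  ext χ h
  change χ (0 ≫ h) = 0
  rw [zero_comp, map_zero]

lemma charMap_sub {M N : C} (f g : M ⟶ N) : charMap X (f - g) = charMap X f - charMap X g := by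
  ext χ h
  change χ ((f - g) ≫ h) = χ (f ≫ h) - χ (g ≫ h)
  rw [Preadditive.sub_comp, map_sub]

@[simp]
lemma bicharMap_id (M : C) : bicharMap X (𝟙 M) = LinearMap.id := by
  ext ξ χ
  simp

lemma bicharMap_comp {M N P : C} (f : M ⟶ N) (g : N ⟶ P) :
    bicharMap X (f ≫ g) = (bicharMap X f).comp (bicharMap X g) := by
  ext ξ χ
  simp [charMap_comp]

lemma bicharMap_comp_apply {M N P : C} (f : M ⟶ N) (g : N ⟶ P)
    (ξ : CharacterModule (CharacterModule (P ⟶ X))) :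
    bicharMap X (f ≫ g) ξ = bicharMap X f (bicharMap X g ξ) := by
  rw [bicharMap_comp]
  rfl

lemma bicharMap_zero (M N : C) : bicharMap X (0 : M ⟶ N) = 0 := by
  ext ξ χ
  change ξ (charMap X 0 χ) = 0
  rw [charMap_zero, LinearMap.zero_apply, map_zero]

lemma bicharMap_sub {M N : C} (f g : M ⟶ N) :
    bicharMap X (f - g) = bicharMap X f - bicharMap X g := by
  ext ξ χ
  change ξ (charMap X (f - g) χ) = ξ (charMap X f χ) - ξ (charMap X g χ)
  rw [charMap_sub, LinearMap.sub_apply, map_sub]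

@[simp]
lemma bicharMap_evalChar {M N : C} (f : M ⟶ N) (u : N ⟶ X) :
    bicharMap X f (evalChar X u) = evalChar X (f ≫ u) := rfl

lemma evalChar_injective (M : C) : Function.Injective (evalChar X (M := M)) := by
  intro u u' h
  rw [← sub_eq_zero]
  refine CharacterModule.eq_zero_of_character_apply fun χ ↦ ?_
  rw [map_sub, sub_eq_zero]
  exact DFunLike.congr_fun h χ

/-- A character that kills every `f ≫ g` is killed by `bicharMap X f ξ`, hence vanishes at `u`; so
`u` is zero modulo the range of precomposition with `f`. This is the source of purity of `X ⟶ J`. -/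
lemma exists_comp_eq_of_bicharMap_eq_evalChar {M N : C} (f : M ⟶ N) (u : M ⟶ X)
    (ξ : CharacterModule (CharacterModule (N ⟶ X))) (h : bicharMap X f ξ = evalChar X u) :
    ∃ g : N ⟶ X, f ≫ g = u := by
  let r := (Preadditive.leftComp X f).toIntLinearMap
  suffices hu : (LinearMap.range r).mkQ u = 0 by
    rw [Submodule.mkQ_apply, Submodule.Quotient.mk_eq_zero] at hu
    exact hu
  refine CharacterModule.eq_zero_of_character_apply fun c ↦ ?_
  let χ : CharacterModule (M ⟶ X) := CharacterModule.dual (LinearMap.range r).mkQ c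
  have hχ : charMap X f χ = 0 := by
    ext g
    change c ((LinearMap.range r).mkQ (r g)) = 0
    rw [← LinearMap.comp_apply, LinearMap.range_mkQ_comp, LinearMap.zero_apply, map_zero]
  have := DFunLike.congr_fun h χ
  rw [bicharMap_apply, hχ, map_zero] at this
  exact this.symm

lemma exact_bicharMap_of_isColimit {M N : C} {f : M ⟶ N} {c : CokernelCofork f}
    (hc : IsColimit c) : Function.Exact (bicharMap X c.π) (bicharMap X f) := by
  refine exact_characterModule_dual (exact_characterModule_dual fun g ↦ ⟨fun hg ↦ ?_, ?_⟩)
  · exact ⟨hc.desc (CokernelCofork.ofπ g hg), hc.fac _ WalkingParallelPair.one⟩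
  · rintro ⟨g, rfl⟩
    change f ≫ c.π ≫ g = 0
    simp

end Character

/-! ### The category of elements of the double dual and its representing object. -/

section Elements

variable {C : Type u} [Category.{v} C] [Preadditive C] {A : Type w} [SmallCategory A]
  (ι : A ⥤ C) (X : C)

/-- The category of elements of the functor `a ↦ Hom(ι a, X)⁺⁺` on `A`. -/
structure BicharElement where
  /-- the underlying object -/
  obj : A
  /-- the double character -/
  elt : CharacterModule (CharacterModule (ι.obj obj ⟶ X))

namespace BicharElement

variable {ι X}

/-- A morphism of elements is a morphism of underlying objects compatible with the elements. -/
@[ext]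
structure Hom (E E' : BicharElement ι X) where
  /-- the underlying morphism -/
  hom : E.obj ⟶ E'.obj
  w : bicharMap X (ι.map hom) E'.elt = E.elt

instance : Category.{w} (BicharElement ι X) where
  Hom := Hom
  id E := ⟨𝟙 _, by simp⟩
  comp f g := ⟨f.hom ≫ g.hom, by rw [Functor.map_comp, bicharMap_comp_apply, g.w, f.w]⟩
  id_comp _ := Hom.ext (Category.id_comp _)
  comp_id _ := Hom.ext (Category.comp_id _)
  assoc _ _ _ := Hom.ext (Category.assoc _ _ _)

variable (ι X) in
/-- The forgetful functor from the category of elements. -/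
@[simps]
def proj : BicharElement ι X ⥤ A where
  obj E := E.obj
  map f := f.hom

lemma small_characterModule (G : Type v) [AddCommGroup G] [Small.{w} G] :
    Small.{w} (CharacterModule G) :=
  small_of_injective (β := G → AddCircle (1 : ℚ)) (f := fun χ ↦ ⇑χ) DFunLike.coe_injective

instance [LocallySmall.{w} C] : Small.{w} (BicharElement ι X) := by
  have (a : A) : Small.{w} (CharacterModule (CharacterModule (ι.obj a ⟶ X))) :=
    have := small_characterModule.{w} (ι.obj a ⟶ X)
    small_characterModule _
  exact small_of_injective
    (β := Σ a : A, CharacterModule (CharacterModule (ι.obj a ⟶ X)))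
    (f := fun E ↦ ⟨E.obj, E.elt⟩) (by rintro ⟨_, _⟩ ⟨_, _⟩ h; cases h; rfl)

instance [LocallySmall.{w} C] : EssentiallySmall.{w} (BicharElement ι X) :=
  essentiallySmall_of_small_of_locallySmall _

variable (ι X) in
lemma isFiltered [ι.Full] [ι.Faithful] [Nonempty A] [HasBinaryBiproducts C] [HasCokernels C]
    (hsum : ∀ a b : A, ι.essImage (ι.obj a ⊞ ι.obj b))
    (hcoker : ∀ {a b : A} (f : ι.obj a ⟶ ι.obj b), ι.essImage (cokernel f)) :
    IsFiltered (BicharElement ι X) where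
  nonempty := ⟨⟨Classical.arbitrary A, 0⟩⟩
  cocone_objs := by
    rintro ⟨a, ξ⟩ ⟨b, η⟩
    obtain ⟨c, ⟨e⟩⟩ := hsum a b
    refine ⟨⟨c, bicharMap X (e.hom ≫ biprod.fst) ξ + bicharMap X (e.hom ≫ biprod.snd) η⟩,
      ⟨ι.preimage (biprod.inl ≫ e.inv), ?_⟩, ⟨ι.preimage (biprod.inr ≫ e.inv), ?_⟩, trivial⟩
    · simp [← bicharMap_comp_apply, bicharMap_zero]
    · simp [← bicharMap_comp_apply, bicharMap_zero]
  cocone_maps := by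
    rintro ⟨a, ξ⟩ ⟨b, η⟩ ⟨f, hf⟩ ⟨g, hg⟩
    dsimp only at f g hf hg
    obtain ⟨c, ⟨e⟩⟩ := hcoker (ι.map f - ι.map g)
    -- Since `η` restricts equally along both maps, exactness extends it to the cokernel of their
    -- difference, which coequalizes them.
    have h0 : bicharMap X (ι.map f - ι.map g) η = 0 := by
      rw [bicharMap_sub, LinearMap.sub_apply, hf, hg, sub_self]
    obtain ⟨ζ, hζ⟩ := (exact_bicharMap_of_isColimit
      (cokernelIsCokernel (ι.map f - ι.map g)) η).1 h0
    refine ⟨⟨c, bicharMap X e.hom ζ⟩,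
      ⟨ι.preimage (cokernel.π (ι.map f - ι.map g) ≫ e.inv), ?_⟩, Hom.ext (ι.map_injective ?_)⟩
    · rw [← bicharMap_comp_apply]
      simpa using hζ
    · have := cokernel.condition (ι.map f - ι.map g)
      rw [Preadditive.sub_comp, sub_eq_zero] at this
      change ι.map (f ≫ _) = ι.map (g ≫ _)
      simp [reassoc_of% this]

end BicharElement

/-- If `ι : A ⥤ C` is fully faithful with finitely presentable values closed under finite
colimits, the functor `a ↦ Hom(ι a, X)⁺⁺` is represented by an object of `C`. -/
lemma exists_represents_bichar [LocallySmall.{w} C] [HasColimitsOfSize.{w, w} C]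
    [ι.Full] [ι.Faithful] [∀ a, IsFinitelyPresentable.{w} (ι.obj a)]
    [IsFiltered (BicharElement ι X)] :
    ∃ (J : C) (σ : ∀ a : A, CharacterModule (CharacterModule (ι.obj a ⟶ X)) → (ι.obj a ⟶ J)),
      (∀ a, Function.Bijective (σ a)) ∧
      ∀ ⦃a b : A⦄ (f : a ⟶ b) ξ, σ a (bicharMap X (ι.map f) ξ) = ι.map f ≫ σ b ξ := by
  let D := BicharElement.proj ι X ⋙ ι
  have : HasColimitsOfShape (BicharElement ι X) C :=
    hasColimitsOfShape_of_essentiallySmall.{w} _ _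
  have : IsCardinalFiltered (BicharElement ι X) ℵ₀ := by
    rwa [isCardinalFiltered_aleph0_iff.{w}]
  have nat ⦃a b : A⦄ (f : a ⟶ b) ξ : colimit.ι D ⟨a, bicharMap X (ι.map f) ξ⟩ =
      ι.map f ≫ colimit.ι D ⟨b, ξ⟩ :=
    (colimit.w D (show (⟨a, bicharMap X (ι.map f) ξ⟩ : BicharElement ι X) ⟶ ⟨b, ξ⟩ from
      ⟨f, rfl⟩)).symm
  refine ⟨colimit D, fun a ξ ↦ colimit.ι D ⟨a, ξ⟩, fun a ↦ ⟨fun ξ η h ↦ ?_, fun φ ↦ ?_⟩, nat⟩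
  -- Maps agreeing in the colimit agree at some stage `(c, ζ)`; faithfulness then makes `ξ` and `η`
  -- the same restriction of `ζ`.
  · obtain ⟨⟨c, ζ⟩, ⟨f, hf⟩, ⟨g, hg⟩, hfg⟩ :=
      IsCardinalPresentable.exists_eq_of_isColimit ℵ₀ (colimit.isColimit D)
      (i₁ := ⟨a, ξ⟩) (i₂ := ⟨a, η⟩) (𝟙 (ι.obj a)) (𝟙 (ι.obj a)) (congrArg (𝟙 (ι.obj a) ≫ ·) h)
    obtain rfl : f = g := ι.map_injective
      ((Category.id_comp _).symm.trans (hfg.trans (Category.id_comp _)))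
    exact hf.symm.trans hg
  · obtain ⟨⟨b, ξ⟩, f, hf⟩ :=
      IsCardinalPresentable.exists_hom_of_isColimit ℵ₀ (colimit.isColimit D) φ
    refine ⟨bicharMap X f ξ, ?_⟩
    obtain ⟨f, rfl⟩ := ι.map_surjective f
    exact (nat f ξ).trans hf

end Elements

/-! ### Morphisms determined by a dense subcategory. -/

section Dense

variable {C : Type u} [Category.{v} C] {A : Type w} [SmallCategory A] (ι : A ⥤ C) [ι.IsDense]

lemma hom_ext_of_isDense {K L : C} {f g : K ⟶ L}
    (h : ∀ ⦃a : A⦄ (p : ι.obj a ⟶ K), p ≫ f = p ≫ g) : f = g :=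
  (ι.denseAt K).hom_ext' fun a p ↦ by
    change 𝟙 _ ≫ p ≫ f = 𝟙 _ ≫ p ≫ g
    rw [h p]

lemma exists_hom_of_isDense {K L : C} (α : ∀ a : A, (ι.obj a ⟶ K) → (ι.obj a ⟶ L))
    (nat : ∀ ⦃a b : A⦄ (f : a ⟶ b) (p : ι.obj b ⟶ K), α a (ι.map f ≫ p) = ι.map f ≫ α b p) :
    ∃ g : K ⟶ L, ∀ (a : A) (p : ι.obj a ⟶ K), p ≫ g = α a p := by
  let t : Cocone (CostructuredArrow.proj ι K ⋙ ι) :=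
    { pt := L
      ι :=
        { app q := α q.left q.hom
          naturality p q f := by
            refine Eq.trans (nat f.left q.hom).symm ?_
            rw [CostructuredArrow.w]
            exact (Category.comp_id _).symm } }
  refine ⟨(ι.denseAt K).desc t, fun a p ↦ ?_⟩
  have h := (ι.denseAt K).fac t (CostructuredArrow.mk p)
  change (𝟙 _ ≫ p) ≫ _ = α a p at h
  rwa [Category.id_comp] at h

end Dense

/-! ### Tensor products with the character functor, and purity. -/

section Tensor

variable {C : Type u} [Category.{v} C] [Preadditive C] {A : Type w} [SmallCategory A]
  (ι : A ⥤ C) (X : C)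

/-- The functor `a ↦ Hom(ι a, X)⁺` on `A`. -/
def charFunctor : A ⥤ AddCommGrpCat.{max w v} where
  obj a := AddCommGrpCat.of (ULift.{w} (CharacterModule (ι.obj a ⟶ X)))
  map f := AddCommGrpCat.ofHom
    { toFun x := ⟨charMap X (ι.map f) x.down⟩
      map_zero' := by ext; simp
      map_add' _ _ := by ext; simp }
  map_id a := by ext; simp
  map_comp f g := by ext; simp [charMap_comp]

/-- The tensor product of the functor `Hom(ι -, K)` with `charFunctor ι X`, computed as a colimit
over the category of elements of the former. -/
noncomputable abbrev charTensor (K : C) : AddCommGrpCat.{max w v} :=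
  colimit (CostructuredArrow.proj ι K ⋙ charFunctor ι X)

/-- The functoriality of `charTensor` in its variable. -/
noncomputable def charTensorMap {K L : C} (h : K ⟶ L) : charTensor ι X K ⟶ charTensor ι X L :=
  colimit.pre (CostructuredArrow.proj ι L ⋙ charFunctor ι X) (CostructuredArrow.map h)

lemma ι_charTensorMap {K L : C} (h : K ⟶ L) (p : CostructuredArrow ι K) :
    colimit.ι (CostructuredArrow.proj ι K ⋙ charFunctor ι X) p ≫ charTensorMap ι X h =
      colimit.ι (CostructuredArrow.proj ι L ⋙ charFunctor ι X)
        ((CostructuredArrow.map h).obj p) :=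
  colimit.ι_pre (CostructuredArrow.proj ι L ⋙ charFunctor ι X) (CostructuredArrow.map h) p

lemma charTensorMap_injective [∀ a, IsFinitelyPresentable.{w} (ι.obj a)] {K L : C} (h : K ⟶ L)
    (hh : pure.{w} C h) [IsFiltered (CostructuredArrow ι K)] [IsFiltered (CostructuredArrow ι L)] :
    Function.Injective (charTensorMap ι X h) := by
  have : PreservesFilteredColimitsOfSize.{w, max w v} (forget AddCommGrpCat.{max w v}) :=
    preservesFilteredColimitsOfSize_of_univLE.{max w v, max w v} _
  rw [injective_iff_map_eq_zero]
  intro x hx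
  obtain ⟨p, y, rfl⟩ := Concrete.colimit_exists_rep _ x
  rw [← ConcreteCategory.comp_apply, ι_charTensorMap] at hx
  obtain ⟨q, f, f₀, hf⟩ := Concrete.colimit_exists_of_rep_eq
    (CostructuredArrow.proj ι L ⋙ charFunctor ι X) (i := (CostructuredArrow.map h).obj p)
    (j := (CostructuredArrow.map h).obj p) y 0 (hx.trans (map_zero _).symm)
  -- The arrow over `L` that kills `y` is a square to which purity applies; the resulting `g` lets
  -- the same arrow kill `y` already over `K`.
  obtain ⟨g, hg⟩ := hh (M := ι.obj p.left) (N := ι.obj q.left) inferInstance inferInstance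
    (ι.map f.left) p.hom q.hom (CostructuredArrow.w f).symm
  let f' : p ⟶ CostructuredArrow.mk g := CostructuredArrow.homMk f.left hg
  have hf' : (CostructuredArrow.proj ι K ⋙ charFunctor ι X).map f' y = 0 :=
    hf.trans (map_zero _)
  rw [← colimit.w _ f', ConcreteCategory.comp_apply, hf', map_zero]

variable {ι X} {J : C}
  {σ : ∀ a : A, CharacterModule (CharacterModule (ι.obj a ⟶ X)) → (ι.obj a ⟶ J)}

lemma isPureInjective_of_represents_bichar [∀ a, IsFinitelyPresentable.{w} (ι.obj a)] [ι.IsDense]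
    [∀ K, IsFiltered (CostructuredArrow ι K)] (hσ : ∀ a, Function.Bijective (σ a))
    (nat : ∀ ⦃a b : A⦄ (f : a ⟶ b) ξ, σ a (bicharMap X (ι.map f) ξ) = ι.map f ≫ σ b ξ) :
    IsPureInjective.{w} J := by
  intro K L h hh g
  let τ (p : CostructuredArrow ι K) : CharacterModule (CharacterModule (ι.obj p.left ⟶ X)) :=
    ((hσ p.left).2 (p.hom ≫ g)).choose
  have hτ (p) : σ _ (τ p) = p.hom ≫ g := ((hσ p.left).2 (p.hom ≫ g)).choose_spec
  have τ_nat {p q : CostructuredArrow ι K} (f : p ⟶ q) :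
      bicharMap X (ι.map f.left) (τ q) = τ p := by
    apply (hσ _).1
    rw [nat, hτ, hτ, CostructuredArrow.w_assoc]
  -- Tensor-hom adjunction: the compatible family `τ`, which encodes `g`, is a cocone with vertex
  -- `ℚ/ℤ`, hence a character `φ` of the tensor product.
  let s : Cocone (CostructuredArrow.proj ι K ⋙ charFunctor ι X) :=
    { pt := AddCommGrpCat.of (ULift.{max w v} (AddCircle (1 : ℚ)))
      ι :=
        { app p := AddCommGrpCat.ofHom
            { toFun x := ⟨τ p x.down⟩
              map_zero' := by ext; exact map_zero (τ p)
              map_add' x y := by ext; exact map_add (τ p) x.down y.down }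
          naturality p q f := by
            ext x
            exact ULift.down_injective (DFunLike.congr_fun (τ_nat f) x.down) } }
  let φ : CharacterModule (charTensor ι X K) :=
    AddEquiv.ulift.toAddMonoidHom.comp (colimit.desc _ s).hom
  have hφ (p : CostructuredArrow ι K) (χ : CharacterModule (ι.obj p.left ⟶ X)) :
      φ ((colimit.ι (CostructuredArrow.proj ι K ⋙ charFunctor ι X) p).hom (ULift.up χ)) = τ p χ :=
    congrArg ULift.down (DFunLike.congr_fun
      (congrArg AddCommGrpCat.Hom.hom (colimit.ι_desc s p)) (ULift.up χ))
  obtain ⟨ψ, hψ⟩ := CharacterModule.dual_surjective_of_injective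
    (charTensorMap ι X h).hom.toIntLinearMap (charTensorMap_injective ι X h hh.1) φ
  let ψ' (q : CostructuredArrow ι L) : CharacterModule (CharacterModule (ι.obj q.left ⟶ X)) :=
    (ψ.comp (colimit.ι (CostructuredArrow.proj ι L ⋙ charFunctor ι X) q).hom).comp
      AddEquiv.ulift.symm.toAddMonoidHom
  have ψ'_nat {p q : CostructuredArrow ι L} (f : p ⟶ q) :
      bicharMap X (ι.map f.left) (ψ' q) = ψ' p := by
    ext χ
    have h := colimit.w (CostructuredArrow.proj ι L ⋙ charFunctor ι X) f
    exact congrArg ψ (DFunLike.congr_fun (congrArg AddCommGrpCat.Hom.hom h) (ULift.up χ))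
  have hψ' (p : CostructuredArrow ι K) : ψ' ((CostructuredArrow.map h).obj p) = τ p := by
    ext χ
    rw [← hφ, ← hψ]
    exact congrArg ψ (DFunLike.congr_fun
      (congrArg AddCommGrpCat.Hom.hom (ι_charTensorMap ι X h p)) (ULift.up χ)).symm
  obtain ⟨g', hg'⟩ := exists_hom_of_isDense ι (K := L) (L := J)
    (fun a p ↦ σ a (ψ' (CostructuredArrow.mk p))) (fun a b f p ↦ by
      rw [← nat]
      exact congrArg (σ a) (ψ'_nat (CostructuredArrow.homMk f :
        CostructuredArrow.mk (ι.map f ≫ p) ⟶ CostructuredArrow.mk p)).symm)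
  refine ⟨g', hom_ext_of_isDense ι fun a p ↦ ?_⟩
  rw [← Category.assoc, hg']
  exact (congrArg (σ a) (hψ' (CostructuredArrow.mk p))).trans (hτ (CostructuredArrow.mk p))

/-- The morphism is evaluation, transported along `σ` and assembled by density. It is monic because
characters separate points. -/
lemma exists_pureMono_of_represents_bichar [ι.Full] [ι.IsDense]
    (hess : ∀ M : C, IsFinitelyPresentable.{w} M → ι.essImage M)
    (hσ : ∀ a, Function.Bijective (σ a))
    (nat : ∀ ⦃a b : A⦄ (f : a ⟶ b) ξ, σ a (bicharMap X (ι.map f) ξ) = ι.map f ≫ σ b ξ) :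
    ∃ j : X ⟶ J, pureMono.{w} C j := by
  obtain ⟨j, fac⟩ := exists_hom_of_isDense ι (fun a u ↦ σ a (evalChar X u))
    (fun a b f u ↦ by rw [← nat, bicharMap_evalChar])
  refine ⟨j, fun M N hM hN f u v huv ↦ ?_, ⟨fun {K} r s hrs ↦ ?_⟩⟩
  · obtain ⟨a, ⟨e⟩⟩ := hess M hM
    obtain ⟨b, ⟨e'⟩⟩ := hess N hN
    obtain ⟨f', hf'⟩ := ι.map_surjective (e.hom ≫ f ≫ e'.inv)
    obtain ⟨ξ, hξ⟩ := (hσ b).2 (e'.hom ≫ v)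
    obtain ⟨g, hg⟩ := exists_comp_eq_of_bicharMap_eq_evalChar (ι.map f') (e.hom ≫ u) ξ (by
      apply (hσ a).1
      rw [nat, hξ, ← fac, hf']
      simp [← huv])
    refine ⟨e'.inv ≫ g, ?_⟩
    rw [← cancel_epi e.hom, ← hg, hf']
    simp
  · refine hom_ext_of_isDense ι fun a p ↦ evalChar_injective _ ((hσ a).1 ?_)
    rw [← fac, ← fac, Category.assoc, Category.assoc, hrs]

end Tensor

lemma isFinitelyPresentable_of_isColimit {C : Type u} [Category.{v} C] [LocallySmall.{w} C]
    {K : Type} [SmallCategory K] [FinCategory K] {Y : K ⥤ C} {c : Cocone Y} (hc : IsColimit c)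
    (h : ∀ k, IsFinitelyPresentable.{w} (Y.obj k)) : IsFinitelyPresentable.{w} c.pt := by
  refine isCardinalPresentable_of_isColimit.{w} c hc ℵ₀ ?_
  rw [hasCardinalLT_aleph0_iff]
  infer_instance

/-- A locally finitely presentable additive category has enough pure injectives. -/
theorem enoughPureInjectives (C : Type u) [Category.{v} C] [Preadditive C]
    [IsLocallyFinitelyPresentable.{w} C] : EnoughPureInjectives.{w} C := by
  intro X
  let P := ObjectProperty.isFinitelyPresentable.{w} C
  let e := (equivSmallModel.{w} P.FullSubcategory).inverse
  let ι := e ⋙ P.ι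
  have hess (M : C) (hM : IsFinitelyPresentable.{w} M) : ι.essImage M :=
    ⟨e.objPreimage ⟨M, hM⟩, ⟨P.ι.mapIso (e.objObjPreimageIso ⟨M, hM⟩)⟩⟩
  have hfp (a : SmallModel.{w} P.FullSubcategory) : IsFinitelyPresentable.{w} (ι.obj a) :=
    (e.obj a).property
  have (K : C) : IsFiltered (CostructuredArrow ι K) :=
    IsFiltered.of_equivalence (CostructuredArrow.pre e P.ι K).asEquivalence.symm
  have : Nonempty (SmallModel.{w} P.FullSubcategory) :=
    ⟨(IsFiltered.nonempty (C := CostructuredArrow ι X)).some.left⟩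
  have : HasFiniteColimits C := hasFiniteColimits_of_hasColimitsOfSize.{w, w} C
  have := HasBinaryBiproducts.of_hasBinaryCoproducts (C := C)
  have : IsFiltered (BicharElement ι X) := BicharElement.isFiltered ι X
    (fun a b ↦ hess _ (isFinitelyPresentable_of_isColimit
      (BinaryBiproduct.isColimit (ι.obj a) (ι.obj b))
      (by rintro ⟨_ | _⟩ <;> exact hfp _)))
    (fun {a b} f ↦ hess _ (isFinitelyPresentable_of_isColimit
      (colimit.isColimit (parallelPair f 0)) (by rintro (_ | _) <;> exact hfp _)))
  obtain ⟨J, σ, hσ, nat⟩ := exists_represents_bichar.{w} ι X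
  obtain ⟨j, hj⟩ := exists_pureMono_of_represents_bichar.{w} hess hσ nat
  exact ⟨J, j, hj, isPureInjective_of_represents_bichar.{w} hσ nat⟩

end PurityLFP

theorem mainTheorem3 (C : Type u) [CategoryTheory.Category.{v} C]
    [CategoryTheory.Preadditive C] [CategoryTheory.IsLocallyFinitelyPresentable.{w} C] :
    PurityLFP.EnoughPureInjectives.{w} C :=
  PurityLFP.enoughPureInjectives.{w} C
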